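/- Let $\mu$ be a finite Borel measure on $\mathbb{C}$ whose support is compact and infinite. Let $\Phi_n$ ($n\ge 0$) be its monic orthogonal polynomials (Gram–Schmidt applied to $1,z,z^2,\dots$ in $L^2(\mu)$), let $\kappa_n=\|\Phi_n\|_{L^2(\mu)}^{-1}$, let $\varphi_n=\kappa_n\Phi_n$ be the orthonormal polynomials, and let $M=(M_{j,k})_{j,k\ge 1}$ be the matrix of the Bergman shift (multiplication by $z$) in the basis $(\varphi_n)$, that is $M_{j,k}=\int z\,\varphi_{k-1}(z)\overline{\varphi_{j-1}(z)}\,d\mu(z)$. The following are equivalent. (a) There are $R>0$ and a function $f$ analytic in $\{z: R<|z|\le\infty\}$ (a subset of the Riemann sphere) such that $$\lim_{n\to\infty}\frac{\Phi_n(z)}{\Phi_{n+1}(z)}=f(z)\qquad\text{for every } z \text{ with } R<|z|\le\infty,$$ where for each finite such $z$ it is understood that $\Phi_{n+1}(z)\neq 0$ for all large $n$, and where $\Phi_n/\Phi_{n+1}$ has the value $0$ at $\infty$. (b) For every integer $j\ge 0$ the limit $$\lim_{n\to\infty}\frac{\kappa_{n-1-j}}{\kappa_{n-1}}\,M_{n-j,n}$$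 exists in $\mathbb{C}$. If either condition holds, then for every integer $j\ge 0$ the limit $$\lim_{n\to\infty}\int z^j|\varphi_n(z)|^2\,d\mu(z)$$ exists in $\mathbb{C}$, and it is determined by the limits in (a) or (b): if $\nu$ is another finite Borel measure on $\mathbb{C}$ with compact infinite support, and either (a) holds for $\mu$ and $\nu$ with the same $R$ and $f$, or for every $j\ge 0$ the limit in (b) exists for both measures and has the same value, then $\int z^j|\varphi_n(z;\nu)|^2\,d\nu(z)$ converges to the same limit as for $\mu$, for every $j\ge 0$. -/

import Mathlib

open MeasureTheory Filter Topology Polynomial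

noncomputable section

namespace BergmanShift

/-- The inner product `⟨p, q⟩ = ∫ p(z) * conj (q(z)) dμ(z)` of two polynomials in `L²(ℂ, μ)`. -/
def polyInner (μ : Measure ℂ) (p q : ℂ[X]) : ℂ :=
  ∫ z, p.eval z * (starRingEnd ℂ) (q.eval z) ∂μ

/-- The monic orthogonal polynomials `Φ_n` of `μ`: Gram-Schmidt orthogonalization (without
normalization) of `1, z, z², …` in `L²(ℂ, μ)`. -/
def monicOP (μ : Measure ℂ) (n : ℕ) : ℂ[X] :=
  X ^ n - ∑ k : Fin n,
    C (polyInner μ (X ^ n) (monicOP μ k) / polyInner μ (monicOP μ k) (monicOP μ k)) * monicOP μ k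
termination_by n
decreasing_by all_goals exact k.isLt

/-- The leading coefficient `κ_n = 1 / ‖Φ_n‖_{L²(μ)}` of the `n`-th orthonormal polynomial. -/
def kappa (μ : Measure ℂ) (n : ℕ) : ℝ :=
  (Real.sqrt (∫ z, ‖(monicOP μ n).eval z‖ ^ 2 ∂μ))⁻¹

/-- The orthonormal polynomials `φ_n = κ_n Φ_n` of `μ`. -/
def orthonormalPoly (μ : Measure ℂ) (n : ℕ) : ℂ[X] :=
  C (kappa μ n : ℂ) * monicOP μ n

/-- The matrix of the Bergman shift `f ↦ z f` in the basis `φ_0, φ_1, …`.  Rows and columns are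
numbered from `0`: `bergmanMatrix μ j k = ⟨z φ_k, φ_j⟩` is the entry that is called `M_{j+1,k+1}`
when rows and columns are numbered from `1`. -/
def bergmanMatrix (μ : Measure ℂ) : Matrix ℕ ℕ ℂ :=
  Matrix.of fun j k => polyInner μ (X * orthonormalPoly μ k) (orthonormalPoly μ j)

/-- The moment `∫ z^j |φ_n(z)|² dμ(z)`. -/
def moment (μ : Measure ℂ) (j n : ℕ) : ℂ :=
  ∫ z, z ^ j * ((‖(orthonormalPoly μ n).eval z‖ ^ 2 : ℝ) : ℂ) ∂μ

/-- The values of the rational function `p / q` on the Riemann sphere, for `deg p ≤ deg q`, away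
from the zeros of `q`; the value at infinity is the quotient of the coefficients of
`z ^ deg q` (see `tendsto_ratioSphere`). -/
def ratioSphere (p q : ℂ[X]) : OnePoint ℂ → ℂ
  | OnePoint.infty => p.coeff q.natDegree / q.leadingCoeff
  | OnePoint.some z => p.eval z / q.eval z

/-- The value at infinity in `ratioSphere` is the limit of the finite values. -/
theorem tendsto_ratioSphere {p q : ℂ[X]} (h : p.degree < q.degree) :
    Tendsto (fun z : ℂ => ratioSphere p q z) (cocompact ℂ) (𝓝 (ratioSphere p q OnePoint.infty)) := by
  have h1 : ratioSphere p q OnePoint.infty = 0 := by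
    simp [ratioSphere, coeff_eq_zero_of_degree_lt (h.trans_le degree_le_natDegree)]
  rw [h1, ← Metric.cobounded_eq_cocompact]
  exact (isLittleO_cobounded_of_degree_lt h).tendsto_div_nhds_zero

/-- The local coordinate `w = 1 / z` of the Riemann sphere at infinity: `w ↦ 1 / w`, `0 ↦ ∞`. -/
def sphereInv (w : ℂ) : OnePoint ℂ :=
  if w = 0 then OnePoint.infty else OnePoint.some w⁻¹

/-- `f` is analytic in `{z : R < |z| ≤ ∞}`. -/
def AnalyticOutside (R : ℝ) (f : OnePoint ℂ → ℂ) : Prop :=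
  AnalyticOnNhd ℂ (fun z : ℂ => f (OnePoint.some z)) {z : ℂ | R < ‖z‖} ∧
    AnalyticAt ℂ (fun w : ℂ => f (sphereInv w)) 0

/-- `f` is analytic in `{z : R < |z| ≤ ∞}` and `Φ_n(z) / Φ_{n+1}(z) → f(z)` at every point of this
set.  At a finite point the quotient has to be defined for all large `n`. -/
def HasRatioLimit (μ : Measure ℂ) (R : ℝ) (f : OnePoint ℂ → ℂ) : Prop :=
  AnalyticOutside R f ∧
    (∀ z : ℂ, R < ‖z‖ →
      (∀ᶠ n in atTop, (monicOP μ (n + 1)).eval z ≠ 0) ∧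
      Tendsto (fun n => ratioSphere (monicOP μ n) (monicOP μ (n + 1)) (OnePoint.some z)) atTop
        (𝓝 (f (OnePoint.some z)))) ∧
    Tendsto (fun n => ratioSphere (monicOP μ n) (monicOP μ (n + 1)) OnePoint.infty) atTop
      (𝓝 (f OnePoint.infty))

/-- `(κ_{n-1-j} / κ_{n-1}) M_{n-j,n} → c` as `n → ∞`, where `M` is numbered from `1`; here
`n - 1 - j` is called `m`. -/
def HasDiagonalLimit (μ : Measure ℂ) (j : ℕ) (c : ℂ) : Prop :=
  Tendsto (fun m : ℕ => ((kappa μ m / kappa μ (m + j) : ℝ) : ℂ) * bergmanMatrix μ m (m + j)) atTop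
    (𝓝 c)

end BergmanShift

end

/-!
Let `R` bound the support of `μ`. Dividing the recurrence `z Φ_n = Φ_{n+1} + ∑_i a_{n,i} Φ_{n-i}`
by `z Φ_{n+1}` and putting `w = 1 / z`, one finds for `r_n = Φ_n / Φ_{n+1}` that
`r_n = w (1 + ∑_i a_{n,i} r_n r_{n-1} ⋯ r_{n-i})`. As `r_n = w + O(w²)`, each Taylor coefficient of
`r_n` at `w = 0` involves only finitely many `a_{m,i}`, and conversely each `a_{n,j}` with `j ≤ n`
is a polynomial in finitely many Taylor coefficients of `r_0, …, r_n`; so convergence of all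
diagonals is the same as convergence of all Taylor coefficients. The numerical range of
multiplication by `z` lies in the disc of radius `R`, which gives `|r_n| ≤ 1 / (|z| - R)`; under
this bound coefficientwise and pointwise convergence are equivalent. The limits `c_i` of the
diagonals determine those of the moments: expanding `z^j Φ_n` by the recurrence, the coefficient of
`Φ_n` converges to the coefficient of `y^j` in `(1 + ∑_i c_i y^{i+1})^j`.
-/

noncomputable section

namespace BergmanShift

/-! ### Inner products of polynomials -/

theorem integrable_of_continuous {μ : Measure ℂ} [IsFiniteMeasure μ] (hc : IsCompact μ.support)
    {f : ℂ → ℂ} (hf : Continuous f) : Integrable f μ := by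
  have hsupp : ∀ᵐ z ∂μ, z ∈ μ.support := Measure.support_mem_ae
  rw [← Measure.restrict_eq_self_of_ae_mem hsupp]
  exact hf.continuousOn.integrableOn_compact hc

theorem integrable_eval_mul_conj_eval {μ : Measure ℂ} [IsFiniteMeasure μ]
    (hc : IsCompact μ.support) (p q : ℂ[X]) :
    Integrable (fun z => p.eval z * (starRingEnd ℂ) (q.eval z)) μ :=
  integrable_of_continuous hc (p.continuous.mul (Complex.continuous_conj.comp q.continuous))

/-- The square of the norm of a polynomial in `L²(μ)`. -/
def polyNormSq (μ : Measure ℂ) (p : ℂ[X]) : ℝ := ∫ z, ‖p.eval z‖ ^ 2 ∂μ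

theorem polyNormSq_nonneg (μ : Measure ℂ) (p : ℂ[X]) : 0 ≤ polyNormSq μ p :=
  integral_nonneg fun _ => by positivity

theorem polyInner_self (μ : Measure ℂ) (p : ℂ[X]) : polyInner μ p p = (polyNormSq μ p : ℂ) := by
  simp only [polyInner, polyNormSq, Complex.mul_conj', ← integral_complex_ofReal,
    Complex.ofReal_pow]

theorem polyNormSq_C_mul (μ : Measure ℂ) (c : ℂ) (p : ℂ[X]) :
    polyNormSq μ (C c * p) = ‖c‖ ^ 2 * polyNormSq μ p := by
  simp only [polyNormSq, eval_mul, eval_C, norm_mul, mul_pow]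
  exact integral_const_mul _ _

theorem conj_polyInner (μ : Measure ℂ) (p q : ℂ[X]) :
    (starRingEnd ℂ) (polyInner μ p q) = polyInner μ q p := by
  simp only [polyInner, ← integral_conj, map_mul, Complex.conj_conj, mul_comm]

theorem polyInner_eq_zero_symm {μ : Measure ℂ} {p q : ℂ[X]} (h : polyInner μ p q = 0) :
    polyInner μ q p = 0 := by
  rw [← conj_polyInner, h, map_zero]

theorem polyInner_C_mul_left (μ : Measure ℂ) (c : ℂ) (p q : ℂ[X]) :
    polyInner μ (C c * p) q = c * polyInner μ p q := by
  simp only [polyInner, eval_mul, eval_C, mul_assoc]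
  exact integral_const_mul _ _

theorem polyInner_C_mul_right (μ : Measure ℂ) (c : ℂ) (p q : ℂ[X]) :
    polyInner μ p (C c * q) = (starRingEnd ℂ) c * polyInner μ p q := by
  rw [← conj_polyInner, polyInner_C_mul_left, map_mul, conj_polyInner]

section CompactSupport

variable {μ : Measure ℂ} [IsFiniteMeasure μ] (hc : IsCompact μ.support)
include hc

theorem polyInner_add_left (p p' q : ℂ[X]) :
    polyInner μ (p + p') q = polyInner μ p q + polyInner μ p' q := by
  simp only [polyInner, eval_add, add_mul]
  exact integral_add (integrable_eval_mul_conj_eval hc p q) (integrable_eval_mul_conj_eval hc p' q)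

theorem polyInner_sub_left (p p' q : ℂ[X]) :
    polyInner μ (p - p') q = polyInner μ p q - polyInner μ p' q := by
  simp only [polyInner, eval_sub, sub_mul]
  exact integral_sub (integrable_eval_mul_conj_eval hc p q) (integrable_eval_mul_conj_eval hc p' q)

theorem polyInner_sum_left {ι : Type*} (s : Finset ι) (p : ι → ℂ[X]) (q : ℂ[X]) :
    polyInner μ (∑ i ∈ s, p i) q = ∑ i ∈ s, polyInner μ (p i) q := by
  simp only [polyInner, eval_finsetSum, Finset.sum_mul]
  exact integral_finsetSum _ fun i _ => integrable_eval_mul_conj_eval hc (p i) q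

theorem polyInner_add_right (p q q' : ℂ[X]) :
    polyInner μ p (q + q') = polyInner μ p q + polyInner μ p q' := by
  simp only [← conj_polyInner μ _ p, polyInner_add_left hc, map_add]

theorem polyNormSq_add_of_orthogonal {p q : ℂ[X]} (h : polyInner μ p q = 0) :
    polyNormSq μ (p + q) = polyNormSq μ p + polyNormSq μ q := by
  have key : (polyNormSq μ (p + q) : ℂ) = polyNormSq μ p + polyNormSq μ q := by
    rw [← polyInner_self, polyInner_add_left hc, polyInner_add_right hc, polyInner_add_right hc, h,
      polyInner_eq_zero_symm h, add_zero, zero_add, polyInner_self, polyInner_self]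
  exact_mod_cast key

theorem integrable_norm_eval_sq (p : ℂ[X]) : Integrable (fun z => ‖p.eval z‖ ^ 2) μ := by
  simpa only [norm_mul, RCLike.norm_conj, ← pow_two] using
    (integrable_eval_mul_conj_eval hc p p).norm

theorem polyNormSq_pos (hi : μ.support.Infinite) {p : ℂ[X]} (hp : p ≠ 0) :
    0 < polyNormSq μ p := by
  refine (polyNormSq_nonneg μ p).lt_of_ne fun h0 => hi ?_
  have hae : ∀ᵐ z ∂μ, p.IsRoot z := by
    filter_upwards [(integral_eq_zero_iff_of_nonneg (fun _ => by positivity)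
      (integrable_norm_eval_sq hc p)).1 h0.symm] with z hz
    simpa using hz
  have hclosed : IsClosed {z | p.IsRoot z} := isClosed_eq p.continuous continuous_const
  exact (finite_setOfPred_isRoot hp).subset (Measure.support_subset_of_isClosed hclosed hae)

end CompactSupport

/-! ### Monic orthogonal polynomials -/

theorem degree_X_pow_sub_monicOP_lt (μ : Measure ℂ) (n : ℕ) :
    ((X ^ n : ℂ[X]) - monicOP μ n).degree < n := by
  induction n using Nat.strong_induction_on with
  | _ n ih =>
    rw [monicOP, sub_sub_cancel, ← mem_degreeLT]
    refine Submodule.sum_mem _ fun k _ => ?_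
    rw [← smul_eq_C_mul]
    refine Submodule.smul_mem _ _ (mem_degreeLT.2 ?_)
    have hk := ih k k.isLt
    have hk' : ((k : ℕ) : WithBot ℕ) < n := by exact_mod_cast k.isLt
    rw [← sub_sub_cancel (X ^ (k : ℕ)) (monicOP μ k)]
    exact (degree_sub_le _ _).trans_lt (max_lt ((degree_X_pow_le _).trans_lt hk') (hk.trans hk'))

theorem degree_monicOP (μ : Measure ℂ) (n : ℕ) : (monicOP μ n).degree = n := by
  have h := degree_X_pow_sub_monicOP_lt μ n
  rw [← sub_sub_cancel (X ^ n) (monicOP μ n),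
    degree_sub_eq_left_of_degree_lt (by rwa [degree_X_pow]), degree_X_pow]

theorem degree_monicOP_lt (μ : Measure ℂ) {m n : ℕ} (h : m < n) : (monicOP μ m).degree < n := by
  rw [degree_monicOP]
  exact_mod_cast h

theorem coeff_monicOP_self (μ : Measure ℂ) (n : ℕ) : (monicOP μ n).coeff n = 1 := by
  have h := coeff_eq_zero_of_degree_lt (degree_X_pow_sub_monicOP_lt μ n)
  rw [coeff_sub, coeff_X_pow_self] at h
  exact (sub_eq_zero.1 h).symm

theorem monicOP_ne_zero (μ : Measure ℂ) (n : ℕ) : monicOP μ n ≠ 0 := fun h => by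
  simpa [h] using coeff_monicOP_self μ n

theorem degree_sub_C_mul_monicOP_lt (μ : Measure ℂ) {p : ℂ[X]} {n : ℕ}
    (hp : p.degree < (n + 1 : ℕ)) : (p - C (p.coeff n) * monicOP μ n).degree < n := by
  rw [degree_lt_iff_coeff_zero] at hp ⊢
  intro m hm
  rcases hm.eq_or_lt with rfl | hm
  · rw [coeff_sub, coeff_C_mul, coeff_monicOP_self, mul_one, sub_self]
  · rw [coeff_sub, hp m hm, coeff_C_mul, coeff_eq_zero_of_degree_lt (degree_monicOP_lt μ hm),
      mul_zero, sub_zero]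

/-- The coefficient of `Φ_m` in the expansion of `p` in the monic orthogonal polynomials. -/
def opCoeff (μ : Measure ℂ) (m : ℕ) (p : ℂ[X]) : ℂ :=
  polyInner μ p (monicOP μ m) / polyInner μ (monicOP μ m) (monicOP μ m)

theorem opCoeff_C_mul (μ : Measure ℂ) (m : ℕ) (c : ℂ) (p : ℂ[X]) :
    opCoeff μ m (C c * p) = c * opCoeff μ m p := by
  simp only [opCoeff, polyInner_C_mul_left, mul_div_assoc]

section OrthogonalPolynomials

variable {μ : Measure ℂ} [IsFiniteMeasure μ] (hc : IsCompact μ.support)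
include hc

theorem opCoeff_add (m : ℕ) (p q : ℂ[X]) :
    opCoeff μ m (p + q) = opCoeff μ m p + opCoeff μ m q := by
  simp only [opCoeff, polyInner_add_left hc, add_div]

theorem opCoeff_sum (m : ℕ) {ι : Type*} (s : Finset ι) (p : ι → ℂ[X]) :
    opCoeff μ m (∑ i ∈ s, p i) = ∑ i ∈ s, opCoeff μ m (p i) := by
  simp only [opCoeff, polyInner_sum_left hc, Finset.sum_div]

variable (hi : μ.support.Infinite)
include hi

theorem polyInner_monicOP_self_ne_zero (n : ℕ) :
    polyInner μ (monicOP μ n) (monicOP μ n) ≠ 0 := by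
  rw [polyInner_self]
  exact_mod_cast (polyNormSq_pos hc hi (monicOP_ne_zero μ n)).ne'

theorem polyInner_monicOP_of_lt {m n : ℕ} (hmn : m < n) :
    polyInner μ (monicOP μ n) (monicOP μ m) = 0 := by
  induction n using Nat.strong_induction_on generalizing m with
  | _ n ih =>
    have hsum : ∀ k : Fin n, k ≠ ⟨m, hmn⟩ →
        polyInner μ (monicOP μ k) (monicOP μ m) = 0 := fun k hk => by
      rcases lt_or_gt_of_ne fun h => hk (Fin.ext h) with h | h
      · exact polyInner_eq_zero_symm (ih m hmn h)
      · exact ih k k.isLt h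
    rw [monicOP, polyInner_sub_left hc, polyInner_sum_left hc, Fintype.sum_eq_single ⟨m, hmn⟩
      fun k hk => by rw [polyInner_C_mul_left, hsum k hk, mul_zero], polyInner_C_mul_left,
      div_mul_cancel₀ _ (polyInner_monicOP_self_ne_zero hc hi m), sub_self]

theorem polyInner_monicOP_of_degree_lt {n : ℕ} {p : ℂ[X]} (hp : p.degree < n) :
    polyInner μ p (monicOP μ n) = 0 := by
  suffices ∀ m ≤ n, ∀ p : ℂ[X], p.degree < m → polyInner μ p (monicOP μ n) = 0 from
    this n le_rfl p hp
  intro m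
  induction m with
  | zero =>
    intro _ p hp
    have hp0 : p = 0 := by simpa [Nat.WithBot.lt_zero_iff] using hp
    simp [hp0, polyInner]
  | succ m ih =>
    intro hm p hp
    have h := ih (by omega) _ (degree_sub_C_mul_monicOP_lt μ hp)
    rwa [polyInner_sub_left hc, polyInner_C_mul_left,
      polyInner_eq_zero_symm (polyInner_monicOP_of_lt hc hi hm), mul_zero, sub_zero] at h

theorem opCoeff_eq_zero {m : ℕ} {p : ℂ[X]} (hp : p.degree < m) : opCoeff μ m p = 0 := by
  rw [opCoeff, polyInner_monicOP_of_degree_lt hc hi hp, zero_div]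

theorem opCoeff_monicOP_self (m : ℕ) : opCoeff μ m (monicOP μ m) = 1 :=
  div_self (polyInner_monicOP_self_ne_zero hc hi m)

theorem opCoeff_monicOP_of_ne {m n : ℕ} (h : m ≠ n) : opCoeff μ m (monicOP μ n) = 0 := by
  rcases lt_or_gt_of_ne h with h | h
  · rw [opCoeff, polyInner_monicOP_of_lt hc hi h, zero_div]
  · exact opCoeff_eq_zero hc hi (degree_monicOP_lt μ h)

theorem opCoeff_eq_coeff {m : ℕ} {p : ℂ[X]} (hp : p.degree < (m + 1 : ℕ)) :
    opCoeff μ m p = p.coeff m := by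
  have h := opCoeff_add hc m (p - C (p.coeff m) * monicOP μ m) (C (p.coeff m) * monicOP μ m)
  rwa [sub_add_cancel, opCoeff_eq_zero hc hi (degree_sub_C_mul_monicOP_lt μ hp), opCoeff_C_mul,
    opCoeff_monicOP_self hc hi, zero_add, mul_one] at h

theorem eq_sum_opCoeff {n : ℕ} {p : ℂ[X]} (hp : p.degree < n) :
    p = ∑ m ∈ Finset.range n, C (opCoeff μ m p) * monicOP μ m := by
  induction n generalizing p with
  | zero => simpa [Nat.WithBot.lt_zero_iff] using hp
  | succ n ih =>
    set q := C (p.coeff n) * monicOP μ n with hq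
    have hcoeff : ∀ m ∈ Finset.range n, opCoeff μ m (p - q) = opCoeff μ m p := fun m hm => by
      have h := opCoeff_add hc m (p - q) q
      rwa [sub_add_cancel, hq, opCoeff_C_mul, opCoeff_monicOP_of_ne hc hi
        (Finset.mem_range.1 hm).ne, mul_zero, add_zero, ← hq, eq_comm] at h
    rw [Finset.sum_range_succ, opCoeff_eq_coeff hc hi hp, ← sub_eq_iff_eq_add,
      ih (degree_sub_C_mul_monicOP_lt μ hp)]
    exact Finset.sum_congr rfl fun m hm => by rw [hcoeff m hm]

theorem polyInner_monicOP_left_of_degree_lt {n : ℕ} {p : ℂ[X]} (hp : p.degree < (n + 1 : ℕ)) :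
    polyInner μ (monicOP μ n) p = (starRingEnd ℂ) (p.coeff n) * polyNormSq μ (monicOP μ n) := by
  rw [← opCoeff_eq_coeff hc hi hp, ← conj_polyInner, ← Complex.conj_ofReal (polyNormSq _ _),
    ← map_mul, opCoeff, ← polyInner_self,
    div_mul_cancel₀ _ (polyInner_monicOP_self_ne_zero hc hi n)]

theorem norm_coeff_sq_mul_polyNormSq_monicOP_le {n : ℕ} {p : ℂ[X]} (hp : p.degree < (n + 1 : ℕ)) :
    ‖p.coeff n‖ ^ 2 * polyNormSq μ (monicOP μ n) ≤ polyNormSq μ p := by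
  have horth : polyInner μ (p - C (p.coeff n) * monicOP μ n) (C (p.coeff n) * monicOP μ n) = 0 := by
    rw [polyInner_C_mul_right,
      polyInner_monicOP_of_degree_lt hc hi (degree_sub_C_mul_monicOP_lt μ hp), mul_zero]
  have hadd := polyNormSq_add_of_orthogonal hc horth
  rw [sub_add_cancel, polyNormSq_C_mul] at hadd
  exact hadd ▸ le_add_of_nonneg_left (polyNormSq_nonneg μ _)

theorem polyNormSq_monicOP_mul_kappa_sq (n : ℕ) :
    polyNormSq μ (monicOP μ n) * kappa μ n ^ 2 = 1 := by
  have h := polyNormSq_pos hc hi (monicOP_ne_zero μ n)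
  have hkappa : kappa μ n = (Real.sqrt (polyNormSq μ (monicOP μ n)))⁻¹ := rfl
  rw [hkappa, inv_pow, Real.sq_sqrt h.le, mul_inv_cancel₀ h.ne']

theorem kappa_ne_zero (n : ℕ) : kappa μ n ≠ 0 := fun h => by
  simpa [h] using polyNormSq_monicOP_mul_kappa_sq hc hi n

theorem opCoeff_eq_polyInner_mul_kappa_sq (n : ℕ) (p : ℂ[X]) :
    opCoeff μ n p = polyInner μ p (monicOP μ n) * (kappa μ n : ℂ) ^ 2 := by
  have h : (polyNormSq μ (monicOP μ n) : ℂ) * (kappa μ n : ℂ) ^ 2 = 1 := by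
    exact_mod_cast polyNormSq_monicOP_mul_kappa_sq hc hi n
  rw [opCoeff, polyInner_self, div_eq_mul_inv, eq_inv_of_mul_eq_one_right h]

theorem moment_eq_opCoeff (j n : ℕ) : moment μ j n = opCoeff μ n (X ^ j * monicOP μ n) := by
  have h : moment μ j n = polyInner μ (X ^ j * orthonormalPoly μ n) (orthonormalPoly μ n) := by
    simp only [moment, polyInner, eval_mul, eval_pow, eval_X, mul_assoc, Complex.mul_conj',
      Complex.ofReal_pow]
  rw [h, opCoeff_eq_polyInner_mul_kappa_sq hc hi, orthonormalPoly, mul_left_comm,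
    polyInner_C_mul_left, polyInner_C_mul_right, Complex.conj_ofReal]
  ring

end OrthogonalPolynomials

/-- The coefficients `a_{n,i}` of the recurrence `z Φ_n = Φ_{n+1} + ∑_{i ≤ n} a_{n,i} Φ_{n-i}`.
For `i > n` the value is meaningless: the subtraction is truncated. -/
def recCoeff (μ : Measure ℂ) (n i : ℕ) : ℂ := opCoeff μ (n - i) (X * monicOP μ n)

section Recurrence

variable {μ : Measure ℂ} [IsFiniteMeasure μ] (hc : IsCompact μ.support) (hi : μ.support.Infinite)
include hc hi

theorem X_mul_monicOP (n : ℕ) :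
    X * monicOP μ n = monicOP μ (n + 1) +
      ∑ i ∈ Finset.range (n + 1), C (recCoeff μ n i) * monicOP μ (n - i) := by
  have hdeg : (X * monicOP μ n : ℂ[X]).degree < (n + 1 + 1 : ℕ) := by
    rw [X_mul, degree_mul_X, degree_monicOP]
    exact_mod_cast Nat.lt_succ_self _
  have h := eq_sum_opCoeff hc hi hdeg
  rw [Finset.sum_range_succ, opCoeff_eq_coeff hc hi hdeg, coeff_X_mul, coeff_monicOP_self, C_1,
    one_mul, add_comm, ← Finset.sum_range_reflect] at h
  simpa only [recCoeff, Nat.add_sub_cancel] using h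

theorem hasDiagonalLimit_iff (j : ℕ) (c : ℂ) :
    HasDiagonalLimit μ j c ↔ Tendsto (fun n => recCoeff μ n j) atTop (𝓝 c) := by
  rw [← tendsto_add_atTop_iff_nat j, HasDiagonalLimit]
  refine tendsto_congr fun m => ?_
  have hk : (kappa μ (m + j) : ℂ) ≠ 0 := by exact_mod_cast kappa_ne_zero hc hi (m + j)
  rw [recCoeff, Nat.add_sub_cancel, opCoeff_eq_polyInner_mul_kappa_sq hc hi, bergmanMatrix,
    Matrix.of_apply, orthonormalPoly, orthonormalPoly, mul_left_comm, polyInner_C_mul_left,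
    polyInner_C_mul_right, Complex.conj_ofReal, Complex.ofReal_div]
  field_simp

end Recurrence

/-! ### Quotients of consecutive orthogonal polynomials -/

theorem degree_lt_of_degree_X_sub_C_mul_lt {z : ℂ} {q : ℂ[X]} {n : ℕ}
    (h : ((X - C z) * q : ℂ[X]).degree < (n + 1 : ℕ)) : q.degree < n := by
  rcases eq_or_ne q 0 with rfl | hq
  · exact WithBot.bot_lt_coe n
  · rw [degree_mul, degree_X_sub_C, degree_eq_natDegree hq] at h
    rw [degree_eq_natDegree hq]
    norm_cast at h ⊢
    omega

theorem exists_monicOP_sub_C_mul_eq (μ : Measure ℂ) {n : ℕ} {z t : ℂ}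
    (ht : (monicOP μ n).eval z = t * (monicOP μ (n + 1)).eval z) :
    ∃ q : ℂ[X], monicOP μ n - C t * monicOP μ (n + 1) = (X - C z) * q ∧
      q.degree < (n + 1 : ℕ) ∧ q.coeff n = -t := by
  have hroot : (monicOP μ n - C t * monicOP μ (n + 1)).IsRoot z := by
    rw [IsRoot, eval_sub, eval_mul, eval_C, ht, sub_self]
  obtain ⟨q, hq⟩ := dvd_iff_isRoot.2 hroot
  have hdeg : q.degree < (n + 1 : ℕ) := by
    refine degree_lt_of_degree_X_sub_C_mul_lt (z := z) ?_
    rw [← hq, ← mem_degreeLT, ← smul_eq_C_mul]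
    exact Submodule.sub_mem _ (mem_degreeLT.2 (degree_monicOP_lt μ (by omega)))
      (Submodule.smul_mem _ _ (mem_degreeLT.2 (degree_monicOP_lt μ (by omega))))
  refine ⟨q, hq, hdeg, ?_⟩
  have h := congrArg (coeff · (n + 1)) hq
  simp only [sub_mul, coeff_sub, coeff_C_mul, coeff_X_mul, coeff_monicOP_self,
    coeff_eq_zero_of_degree_lt (degree_monicOP_lt μ n.lt_succ_self),
    coeff_eq_zero_of_degree_lt hdeg] at h
  linear_combination -h

section NumericalRange

variable {μ : Measure ℂ} [IsFiniteMeasure μ] {R : ℝ} (hR : μ.support ⊆ Metric.closedBall 0 R)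
include hR

omit [IsFiniteMeasure μ] in
theorem isCompact_support_of_subset_closedBall : IsCompact μ.support :=
  (isCompact_closedBall 0 R).of_isClosed_subset Measure.isClosed_support hR

theorem norm_polyInner_X_mul_self_le (p : ℂ[X]) :
    ‖polyInner μ (X * p) p‖ ≤ R * polyNormSq μ p := by
  have hc := isCompact_support_of_subset_closedBall hR
  rw [polyNormSq, ← integral_const_mul]
  refine norm_integral_le_of_norm_le ((integrable_norm_eval_sq hc p).const_mul R) ?_
  filter_upwards [Measure.support_mem_ae (μ := μ)] with z hz
  have hzR : ‖z‖ ≤ R := by simpa using hR hz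
  rw [eval_mul, eval_X, norm_mul, norm_mul, RCLike.norm_conj, mul_assoc, ← pow_two]
  gcongr

theorem sub_mul_polyNormSq_le_norm_polyInner (z : ℂ) (p : ℂ[X]) :
    (‖z‖ - R) * polyNormSq μ p ≤ ‖polyInner μ ((X - C z) * p) p‖ := by
  have hc := isCompact_support_of_subset_closedBall hR
  rw [sub_mul (X : ℂ[X]), polyInner_sub_left hc, polyInner_C_mul_left, polyInner_self,
    norm_sub_rev]
  refine le_trans ?_ (norm_sub_norm_le _ _)
  rw [norm_mul, Complex.norm_of_nonneg (polyNormSq_nonneg μ p), sub_mul]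
  exact sub_le_sub_left (norm_polyInner_X_mul_self_le hR p) _

variable (hi : μ.support.Infinite)
include hi

theorem eval_monicOP_ne_zero {z : ℂ} (hz : R < ‖z‖) (n : ℕ) : (monicOP μ n).eval z ≠ 0 := by
  intro h0
  have hc := isCompact_support_of_subset_closedBall hR
  obtain ⟨q, hq⟩ := dvd_iff_isRoot.2 h0
  have hq0 : q ≠ 0 := by
    rintro rfl
    exact monicOP_ne_zero μ n (by rw [hq, mul_zero])
  have hdeg : q.degree < n :=
    degree_lt_of_degree_X_sub_C_mul_lt (hq ▸ degree_monicOP_lt μ n.lt_succ_self)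
  have hpos := mul_pos (sub_pos.2 hz) (polyNormSq_pos hc hi hq0)
  have hle := sub_mul_polyNormSq_le_norm_polyInner hR z q
  rw [← hq, polyInner_eq_zero_symm (polyInner_monicOP_of_degree_lt hc hi hdeg), norm_zero] at hle
  exact hpos.not_ge hle

theorem norm_eval_monicOP_div_le {z : ℂ} (hz : R < ‖z‖) (n : ℕ) :
    ‖(monicOP μ n).eval z / (monicOP μ (n + 1)).eval z‖ ≤ (‖z‖ - R)⁻¹ := by
  have hc := isCompact_support_of_subset_closedBall hR
  set t := (monicOP μ n).eval z / (monicOP μ (n + 1)).eval z with ht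
  obtain ⟨q, hq, hdeg, hcoeff⟩ := exists_monicOP_sub_C_mul_eq μ
    (div_mul_cancel₀ ((monicOP μ n).eval z) (eval_monicOP_ne_zero hR hi hz (n + 1))).symm
  rw [← ht] at hq hcoeff
  have hpos : 0 < polyNormSq μ (monicOP μ n) := polyNormSq_pos hc hi (monicOP_ne_zero μ n)
  have hinner : ‖polyInner μ ((X - C z) * q) q‖ = ‖t‖ * polyNormSq μ (monicOP μ n) := by
    rw [← hq, polyInner_sub_left hc, polyInner_C_mul_left,
      polyInner_eq_zero_symm (polyInner_monicOP_of_degree_lt hc hi hdeg), mul_zero, sub_zero,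
      polyInner_monicOP_left_of_degree_lt hc hi hdeg, hcoeff, norm_mul, RCLike.norm_conj, norm_neg,
      Complex.norm_of_nonneg hpos.le]
  have hbound : (‖z‖ - R) * ‖t‖ ^ 2 ≤ ‖t‖ := by
    have hnorm := norm_coeff_sq_mul_polyNormSq_monicOP_le hc hi hdeg
    rw [hcoeff, norm_neg] at hnorm
    refine le_of_mul_le_mul_right ?_ hpos
    calc (‖z‖ - R) * ‖t‖ ^ 2 * polyNormSq μ (monicOP μ n)
        ≤ (‖z‖ - R) * polyNormSq μ q := by
          rw [mul_assoc]
          exact mul_le_mul_of_nonneg_left hnorm (sub_pos.2 hz).le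
      _ ≤ ‖t‖ * polyNormSq μ (monicOP μ n) :=
          hinner ▸ sub_mul_polyNormSq_le_norm_polyInner hR z q
  rw [← one_div, le_div_iff₀' (sub_pos.2 hz)]
  rcases (norm_nonneg t).eq_or_lt with h0 | h0
  · rw [← h0, mul_zero]
    exact zero_le_one
  · exact le_of_mul_le_mul_right (by linarith) h0

end NumericalRange

/-- The quotient `Φ_n / Φ_{n+1}` in the local coordinate `w = 1 / z` of the Riemann sphere at
infinity. -/
def ratioAtInfty (μ : Measure ℂ) (n : ℕ) (w : ℂ) : ℂ :=
  ratioSphere (monicOP μ n) (monicOP μ (n + 1)) (sphereInv w)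

theorem ratioAtInfty_of_ne_zero (μ : Measure ℂ) (n : ℕ) {w : ℂ} (hw : w ≠ 0) :
    ratioAtInfty μ n w = (monicOP μ n).eval w⁻¹ / (monicOP μ (n + 1)).eval w⁻¹ := by
  rw [ratioAtInfty, sphereInv, if_neg hw]
  rfl

theorem ratioAtInfty_zero (μ : Measure ℂ) (n : ℕ) : ratioAtInfty μ n 0 = 0 := by
  rw [ratioAtInfty, sphereInv, if_pos rfl]
  simp [ratioSphere, natDegree_eq_of_degree_eq_some (degree_monicOP μ (n + 1)),
    coeff_eq_zero_of_degree_lt (degree_monicOP_lt μ n.lt_succ_self)]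

theorem continuousAt_ratioAtInfty_zero (μ : Measure ℂ) (n : ℕ) :
    ContinuousAt (ratioAtInfty μ n) 0 := by
  have hdeg : (monicOP μ n).degree < (monicOP μ (n + 1)).degree := by
    rw [degree_monicOP μ (n + 1)]
    exact degree_monicOP_lt μ n.lt_succ_self
  have hlim := tendsto_ratioSphere hdeg
  rw [← Metric.cobounded_eq_cocompact] at hlim
  rw [continuousAt_iff_punctured_nhds]
  have hzero : sphereInv 0 = OnePoint.infty := if_pos rfl
  rw [ratioAtInfty, hzero]
  refine (hlim.comp tendsto_inv₀_nhdsNE_zero).congr' ?_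
  filter_upwards [self_mem_nhdsWithin] with w hw
  exact (ratioAtInfty_of_ne_zero μ n hw).symm

theorem lt_norm_inv_of_mem_ball {R : ℝ} (hR : 0 < R) {w : ℂ} (hw0 : w ≠ 0)
    (hw : w ∈ Metric.ball 0 R⁻¹) : R < ‖w⁻¹‖ := by
  rw [norm_inv]
  exact (lt_inv_comm₀ hR (norm_pos_iff.2 hw0)).2 (mem_ball_zero_iff.1 hw)

section RatioAtInfty

variable {μ : Measure ℂ} [IsFiniteMeasure μ] {R : ℝ} (hR0 : 0 < R)
  (hR : μ.support ⊆ Metric.closedBall 0 R) (hi : μ.support.Infinite)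
include hR0 hR hi

theorem differentiableOn_ratioAtInfty (n : ℕ) :
    DifferentiableOn ℂ (ratioAtInfty μ n) (Metric.ball 0 R⁻¹) := by
  have hball : Metric.ball (0 : ℂ) R⁻¹ ∈ 𝓝 0 := Metric.ball_mem_nhds 0 (inv_pos.2 hR0)
  refine (Complex.differentiableOn_compl_singleton_and_continuousAt_iff hball).1
    ⟨?_, continuousAt_ratioAtInfty_zero μ n⟩
  refine DifferentiableOn.congr (f := fun w => (monicOP μ n).eval w⁻¹ /
    (monicOP μ (n + 1)).eval w⁻¹) ?_ fun w hw => ratioAtInfty_of_ne_zero μ n hw.2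
  have hinv : DifferentiableOn ℂ (fun w : ℂ => w⁻¹) (Metric.ball 0 R⁻¹ \ {0}) :=
    differentiableOn_inv.mono fun w hw => hw.2
  exact ((monicOP μ n).differentiable.comp_differentiableOn hinv).div
    ((monicOP μ (n + 1)).differentiable.comp_differentiableOn hinv)
    fun w hw => eval_monicOP_ne_zero hR hi (lt_norm_inv_of_mem_ball hR0 hw.2 hw.1) (n + 1)

theorem norm_ratioAtInfty_le {ρ : ℝ} (hρ0 : 0 < ρ) (hρ : ρ < R⁻¹) (n : ℕ) {w : ℂ}
    (hw : w ∈ Metric.closedBall 0 ρ) : ‖ratioAtInfty μ n w‖ ≤ (ρ⁻¹ - R)⁻¹ := by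
  have hρR : 0 < ρ⁻¹ - R := sub_pos.2 ((lt_inv_comm₀ hR0 hρ0).2 hρ)
  rcases eq_or_ne w 0 with rfl | hw0
  · rw [ratioAtInfty_zero, norm_zero]
    exact (inv_pos.2 hρR).le
  · have hwρ : ρ⁻¹ ≤ ‖w⁻¹‖ := by
      rw [norm_inv]
      exact inv_anti₀ (norm_pos_iff.2 hw0) (mem_closedBall_zero_iff.1 hw)
    rw [ratioAtInfty_of_ne_zero μ n hw0]
    exact (norm_eval_monicOP_div_le hR hi (by linarith) n).trans (inv_anti₀ hρR (by linarith))

theorem prod_ratioAtInfty {w : ℂ} (hw0 : w ≠ 0) (hw : w ∈ Metric.ball 0 R⁻¹) {n i : ℕ}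
    (hin : i ≤ n) : ∏ s ∈ Finset.range (i + 1), ratioAtInfty μ (n - s) w =
      (monicOP μ (n - i)).eval w⁻¹ / (monicOP μ (n + 1)).eval w⁻¹ := by
  induction i with
  | zero => rw [Finset.prod_range_one, ratioAtInfty_of_ne_zero μ _ hw0, Nat.sub_zero]
  | succ i ih =>
    rw [Finset.prod_range_succ, ih (by omega), ratioAtInfty_of_ne_zero μ _ hw0, mul_comm,
      show n - (i + 1) + 1 = n - i by omega, div_mul_div_cancel₀]
    exact eval_monicOP_ne_zero hR hi (lt_norm_inv_of_mem_ball hR0 hw0 hw) _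

theorem ratioAtInfty_eq {w : ℂ} (hw : w ∈ Metric.ball 0 R⁻¹) (n : ℕ) :
    ratioAtInfty μ n w = w * (1 + ∑ i ∈ Finset.range (n + 1),
      recCoeff μ n i * ∏ s ∈ Finset.range (i + 1), ratioAtInfty μ (n - s) w) := by
  rcases eq_or_ne w 0 with rfl | hw0
  · rw [ratioAtInfty_zero, zero_mul]
  have hc := isCompact_support_of_subset_closedBall hR
  have hne := eval_monicOP_ne_zero hR hi (lt_norm_inv_of_mem_ball hR0 hw0 hw) (n + 1)
  have hrec := congrArg (eval w⁻¹) (X_mul_monicOP hc hi n)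
  simp only [eval_mul, eval_X, eval_add, eval_finsetSum, eval_C] at hrec
  rw [inv_mul_eq_iff_eq_mul₀ hw0] at hrec
  rw [ratioAtInfty_of_ne_zero μ n hw0, Finset.sum_congr rfl fun i hin => by
    rw [prod_ratioAtInfty hR0 hR hi hw0 hw (Finset.mem_range_succ_iff.1 hin), mul_div_assoc'],
    ← Finset.sum_div, one_add_div hne, mul_div_assoc', hrec]

end RatioAtInfty

/-! ### Taylor series -/

/-- The Taylor series of `f` at `0`, as a formal power series. -/
def taylorSeriesAtZero (f : ℂ → ℂ) : PowerSeries ℂ :=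
  PowerSeries.mk fun k => (k.factorial : ℂ)⁻¹ * iteratedDeriv k f 0

theorem coeff_taylorSeriesAtZero (f : ℂ → ℂ) (k : ℕ) :
    PowerSeries.coeff k (taylorSeriesAtZero f) = (k.factorial : ℂ)⁻¹ * iteratedDeriv k f 0 :=
  PowerSeries.coeff_mk _ _

theorem taylorSeriesAtZero_congr {f g : ℂ → ℂ} (h : f =ᶠ[𝓝 0] g) :
    taylorSeriesAtZero f = taylorSeriesAtZero g := by
  simp only [taylorSeriesAtZero, h.iteratedDeriv_eq]

theorem taylorSeriesAtZero_const (c : ℂ) :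
    taylorSeriesAtZero (fun _ => c) = PowerSeries.C c := by
  ext k
  rw [coeff_taylorSeriesAtZero, iteratedDeriv_const, PowerSeries.coeff_C]
  split_ifs with hk <;> simp [hk]

theorem taylorSeriesAtZero_id : taylorSeriesAtZero (fun w => w) = PowerSeries.X := by
  ext k
  rw [coeff_taylorSeriesAtZero, iteratedDeriv_fun_id_zero, PowerSeries.coeff_X]
  split_ifs with hk <;> simp [hk]

theorem taylorSeriesAtZero_add {f g : ℂ → ℂ} (hf : AnalyticAt ℂ f 0) (hg : AnalyticAt ℂ g 0) :
    taylorSeriesAtZero (fun w => f w + g w) = taylorSeriesAtZero f + taylorSeriesAtZero g := by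
  ext k
  simp only [coeff_taylorSeriesAtZero, map_add,
    iteratedDeriv_fun_add hf.contDiffAt hg.contDiffAt, mul_add]

theorem taylorSeriesAtZero_sum {ι : Type*} (s : Finset ι) {f : ι → ℂ → ℂ}
    (hf : ∀ i ∈ s, AnalyticAt ℂ (f i) 0) :
    taylorSeriesAtZero (fun w => ∑ i ∈ s, f i w) = ∑ i ∈ s, taylorSeriesAtZero (f i) := by
  ext k
  simp only [coeff_taylorSeriesAtZero, map_sum,
    iteratedDeriv_fun_sum fun i hi => (hf i hi).contDiffAt, Finset.mul_sum]

theorem taylorSeriesAtZero_mul {f g : ℂ → ℂ} (hf : AnalyticAt ℂ f 0) (hg : AnalyticAt ℂ g 0) :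
    taylorSeriesAtZero (fun w => f w * g w) = taylorSeriesAtZero f * taylorSeriesAtZero g := by
  ext k
  rw [coeff_taylorSeriesAtZero, iteratedDeriv_fun_mul hf.contDiffAt hg.contDiffAt,
    PowerSeries.coeff_mul, Finset.Nat.sum_antidiagonal_eq_sum_range_succ_mk, Finset.mul_sum]
  refine Finset.sum_congr rfl fun i hi => ?_
  rw [coeff_taylorSeriesAtZero, coeff_taylorSeriesAtZero,
    Nat.cast_choose ℂ (Finset.mem_range_succ_iff.1 hi)]
  field_simp [Nat.factorial_ne_zero]

theorem taylorSeriesAtZero_prod {ι : Type*} (s : Finset ι) {f : ι → ℂ → ℂ}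
    (hf : ∀ i ∈ s, AnalyticAt ℂ (f i) 0) :
    taylorSeriesAtZero (fun w => ∏ i ∈ s, f i w) = ∏ i ∈ s, taylorSeriesAtZero (f i) := by
  induction s using Finset.cons_induction with
  | empty => simpa only [Finset.prod_empty, map_one] using taylorSeriesAtZero_const 1
  | cons i s hi ih =>
    rw [Finset.forall_mem_cons] at hf
    simp only [Finset.prod_cons]
    rw [taylorSeriesAtZero_mul hf.1 (s.analyticAt_fun_prod hf.2), ih hf.2]

theorem summable_div_pow_mul_pow (B : ℝ) {r ρ : ℝ} (hr : 0 ≤ r) (hrρ : r < ρ) :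
    Summable fun k : ℕ => B / ρ ^ k * r ^ k := by
  have hρ : 0 < ρ := hr.trans_lt hrρ
  simp_rw [div_mul_eq_mul_div, mul_div_assoc, ← div_pow]
  exact (summable_geometric_of_lt_one (by positivity) ((div_lt_one hρ).2 hrρ)).mul_left B

theorem norm_mul_pow_le_div_pow_mul_pow {x w : ℂ} {B r ρ : ℝ} {k : ℕ} (hx : ‖x‖ ≤ B / ρ ^ k)
    (hw : ‖w‖ ≤ r) : ‖x * w ^ k‖ ≤ B / ρ ^ k * r ^ k := by
  rw [norm_mul, norm_pow]
  exact mul_le_mul hx (pow_le_pow_left₀ (norm_nonneg w) hw k) (by positivity)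
    ((norm_nonneg x).trans hx)

theorem differentiableOn_tsum_mul_pow {x : ℕ → ℂ} {B ρ : ℝ} (hx : ∀ k, ‖x k‖ ≤ B / ρ ^ k) :
    DifferentiableOn ℂ (fun w => ∑' k, x k * w ^ k) (Metric.ball 0 ρ) := by
  intro w hw
  obtain ⟨r, hwr, hrρ⟩ := exists_between (mem_ball_zero_iff.1 hw)
  have hdiff := Complex.differentiableOn_tsum_of_summable_norm (F := fun k w => x k * w ^ k)
    (summable_div_pow_mul_pow B ((norm_nonneg w).trans hwr.le) hrρ)
    (fun k => ((differentiable_pow k).const_mul (x k)).differentiableOn) Metric.isOpen_ball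
    fun k w hw => norm_mul_pow_le_div_pow_mul_pow (hx k) (mem_ball_zero_iff.1 hw).le
  exact (hdiff.differentiableAt
    (Metric.isOpen_ball.mem_nhds (mem_ball_zero_iff.2 hwr))).differentiableWithinAt

section BoundedConvergence

variable {ι : Type*} {l : Filter ι} {F : ι → ℂ → ℂ} {ρ B : ℝ} (hρ : 0 < ρ)
  (hF : ∀ i, DiffContOnCl ℂ (F i) (Metric.ball 0 ρ))
  (hB : ∀ i, ∀ w ∈ Metric.sphere (0 : ℂ) ρ, ‖F i w‖ ≤ B)
include hρ hF hB

theorem tendsto_coeff_taylorSeriesAtZero [l.IsCountablyGenerated] {g : ℂ → ℂ}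
    (hg : DiffContOnCl ℂ g (Metric.ball 0 ρ))
    (hlim : ∀ w ∈ Metric.sphere (0 : ℂ) ρ, Tendsto (fun i => F i w) l (𝓝 (g w))) (k : ℕ) :
    Tendsto (fun i => PowerSeries.coeff k (taylorSeriesAtZero (F i))) l
      (𝓝 (PowerSeries.coeff k (taylorSeriesAtZero g))) := by
  have hcauchy : ∀ f : ℂ → ℂ, DiffContOnCl ℂ f (Metric.ball 0 ρ) →
      PowerSeries.coeff k (taylorSeriesAtZero f) = (2 * Real.pi * Complex.I)⁻¹ *
        ∮ w in C(0, ρ), (1 / (w - 0) ^ (k + 1)) • f w := fun f hf => by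
    rw [hf.circleIntegral_one_div_sub_center_pow_smul hρ, coeff_taylorSeriesAtZero, smul_eq_mul]
    field_simp [Complex.two_pi_I_ne_zero]
  have hkernel : Continuous fun θ : ℝ =>
      deriv (circleMap 0 ρ) θ * (1 / (circleMap 0 ρ θ - 0) ^ (k + 1)) := by
    simp only [deriv_circleMap, sub_zero]
    exact ((continuous_circleMap 0 ρ).mul continuous_const).mul (continuous_const.div
      ((continuous_circleMap 0 ρ).pow _) fun θ => pow_ne_zero _ (circleMap_ne_center hρ.ne'))
  have hcirc : ∀ θ, circleMap 0 ρ θ ∈ Metric.sphere (0 : ℂ) ρ := circleMap_mem_sphere 0 hρ.le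
  simp only [hcauchy _ (hF _), hcauchy g hg, circleIntegral]
  simp only [smul_eq_mul, ← mul_assoc]
  refine Tendsto.const_mul _ (intervalIntegral.tendsto_integral_filter_of_dominated_convergence
    (fun θ => ‖deriv (circleMap 0 ρ) θ * (1 / (circleMap 0 ρ θ - 0) ^ (k + 1))‖ * B) ?_ ?_
    ((hkernel.norm.mul continuous_const).intervalIntegrable _ _)
    (.of_forall fun θ _ => (hlim _ (hcirc θ)).const_mul _))
  · refine .of_forall fun i => (hkernel.mul ?_).aestronglyMeasurable
    exact (hF i).continuousOn_ball.comp_continuous (continuous_circleMap 0 ρ) fun θ =>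
      Metric.sphere_subset_closedBall (hcirc θ)
  · refine .of_forall fun i => .of_forall fun θ _ => ?_
    rw [norm_mul]
    exact mul_le_mul_of_nonneg_left (hB i _ (hcirc θ)) (norm_nonneg _)

theorem norm_coeff_taylorSeriesAtZero_le (i : ι) (k : ℕ) :
    ‖PowerSeries.coeff k (taylorSeriesAtZero (F i))‖ ≤ B / ρ ^ k := by
  have h := Complex.norm_iteratedDeriv_le_of_forall_mem_sphere_norm_le k hρ (hF i) (hB i)
  have hk : (0 : ℝ) < k.factorial := by exact_mod_cast k.factorial_pos
  rw [coeff_taylorSeriesAtZero, norm_mul, norm_inv, Complex.norm_natCast, inv_mul_le_iff₀ hk,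
    mul_div_assoc']
  exact h

theorem tendsto_tsum_of_tendsto_coeff_taylorSeriesAtZero {x : ℕ → ℂ}
    (hx : ∀ k, Tendsto (fun i => PowerSeries.coeff k (taylorSeriesAtZero (F i))) l (𝓝 (x k)))
    {w : ℂ} (hw : w ∈ Metric.ball 0 ρ) : Tendsto (fun i => F i w) l (𝓝 (∑' k, x k * w ^ k)) := by
  have htaylor : ∀ i, F i w = ∑' k, PowerSeries.coeff k (taylorSeriesAtZero (F i)) * w ^ k :=
    fun i => by
      rw [← (Complex.hasSum_taylorSeries_on_ball (hF i).differentiableOn hw).tsum_eq]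
      refine tsum_congr fun k => ?_
      rw [coeff_taylorSeriesAtZero, sub_zero, smul_eq_mul, smul_eq_mul]
      ring
  simp only [htaylor]
  exact tendsto_tsum_of_dominated_convergence
    (summable_div_pow_mul_pow B (norm_nonneg w) (mem_ball_zero_iff.1 hw))
    (fun k => (hx k).mul_const _) (.of_forall fun i k =>
      norm_mul_pow_le_div_pow_mul_pow (norm_coeff_taylorSeriesAtZero_le hρ hF hB i k) le_rfl)

end BoundedConvergence

/-! ### The recurrence for power series -/

theorem tendsto_coeff_prod {A ι κ : Type*} [CommSemiring A] [TopologicalSpace A]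
    [IsTopologicalSemiring A] (s : Finset ι) {l : Filter κ} {f : κ → ι → PowerSeries A}
    {g : ι → PowerSeries A} {k : ℕ} (h : ∀ i ∈ s, ∀ m ≤ k,
      Tendsto (fun n => PowerSeries.coeff m (f n i)) l (𝓝 (PowerSeries.coeff m (g i)))) :
    Tendsto (fun n => PowerSeries.coeff k (∏ i ∈ s, f n i)) l
      (𝓝 (PowerSeries.coeff k (∏ i ∈ s, g i))) := by
  classical
  simp only [PowerSeries.coeff_prod]
  refine tendsto_finsetSum _ fun d hd => tendsto_finsetProd _ fun i hi => h i hi _ ?_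
  rw [← (Finset.mem_finsuppAntidiag.1 hd).1]
  exact Finset.single_le_sum (fun _ _ => Nat.zero_le _) hi

theorem tendsto_coeff_prod_range {A : Type*} [CommSemiring A] [TopologicalSpace A]
    [IsTopologicalSemiring A] {r : ℕ → PowerSeries A} {ρ : PowerSeries A} {k : ℕ} (i : ℕ)
    (hr : ∀ m ≤ k, Tendsto (fun n => PowerSeries.coeff m (r n)) atTop
      (𝓝 (PowerSeries.coeff m ρ))) :
    Tendsto (fun n => PowerSeries.coeff k (∏ s ∈ Finset.range (i + 1), r (n - s))) atTop
      (𝓝 (PowerSeries.coeff k (ρ ^ (i + 1)))) := by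
  rw [← Finset.card_range (i + 1), ← Finset.prod_const, Finset.card_range]
  exact tendsto_coeff_prod _ fun s _ m hm => (hr m hm).comp (tendsto_sub_atTop_nat s)

section RatioRecurrence

variable {A : Type*} [CommRing A]

/-- The recurrence `r_n = X (1 + ∑_{i ≤ n} a_{n,i} r_n r_{n-1} ⋯ r_{n-i})`, satisfied by the Taylor
series of the quotients `Φ_n / Φ_{n+1}` at infinity. -/
def IsRatioRecurrence (a : ℕ → ℕ → A) (r : ℕ → PowerSeries A) : Prop :=
  ∀ n, r n = PowerSeries.X * (1 + ∑ i ∈ Finset.range (n + 1),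
    PowerSeries.C (a n i) * ∏ s ∈ Finset.range (i + 1), r (n - s))

/-- The coefficients `c_j` for which `ρ = X (1 + ∑_j c_j ρ^{j+1})`, when `ρ` has the form
`X + O(X²)`. -/
def symbolCoeff (ρ : PowerSeries A) (j : ℕ) : A :=
  PowerSeries.coeff (j + 2) ρ -
    ∑ i : Fin j, symbolCoeff ρ i * PowerSeries.coeff (j + 1) (ρ ^ (i + 1 : ℕ))
termination_by j
decreasing_by exact i.isLt

namespace IsRatioRecurrence

variable {a : ℕ → ℕ → A} {r : ℕ → PowerSeries A} (h : IsRatioRecurrence a r)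
include h

theorem exists_eq_X_mul :
    ∃ u : ℕ → PowerSeries A, (∀ n, r n = PowerSeries.X * u n) ∧
      ∀ n, PowerSeries.constantCoeff (u n) = 1 := by
  refine ⟨_, h, fun n => ?_⟩
  have hconst : ∀ n, PowerSeries.constantCoeff (r n) = 0 := fun n => by
    rw [h n, map_mul, PowerSeries.constantCoeff_X, zero_mul]
  simp [hconst]

theorem coeff_prod_range (n i k : ℕ) (hk : k ≤ i + 1) :
    PowerSeries.coeff k (∏ s ∈ Finset.range (i + 1), r (n - s)) = if k = i + 1 then 1 else 0 := by
  obtain ⟨u, hu, hconst⟩ := h.exists_eq_X_mul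
  simp only [hu, Finset.prod_mul_distrib, Finset.prod_const, Finset.card_range,
    PowerSeries.coeff_X_pow_mul']
  rcases hk.eq_or_lt with rfl | hk
  · simp [hconst]
  · rw [if_neg hk.not_ge, if_neg hk.ne]

theorem coeff_succ {n k : ℕ} (hk : k ≤ n + 1) :
    PowerSeries.coeff (k + 1) (r n) = PowerSeries.coeff k (1 : PowerSeries A) +
      ∑ i ∈ Finset.range k,
        a n i * PowerSeries.coeff k (∏ s ∈ Finset.range (i + 1), r (n - s)) := by
  rw [h n, PowerSeries.coeff_succ_X_mul, map_add, map_sum]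
  simp only [PowerSeries.coeff_C_mul]
  congr 1
  refine (Finset.sum_subset (Finset.range_mono hk) fun i _ hi => ?_).symm
  have hik : k ≤ i := by simpa using hi
  rw [h.coeff_prod_range n i k (by omega), if_neg (by omega), mul_zero]

variable [TopologicalSpace A] [IsTopologicalRing A]

theorem tendsto_symbolCoeff {ρ : PowerSeries A}
    (hr : ∀ k, Tendsto (fun n => PowerSeries.coeff k (r n)) atTop (𝓝 (PowerSeries.coeff k ρ)))
    (j : ℕ) : Tendsto (fun n => a n j) atTop (𝓝 (symbolCoeff ρ j)) := by
  induction j using Nat.strong_induction_on with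
  | _ j ih =>
    rw [symbolCoeff, Fin.sum_univ_eq_sum_range fun i =>
      symbolCoeff ρ i * PowerSeries.coeff (j + 1) (ρ ^ (i + 1))]
    refine ((hr (j + 2)).sub (tendsto_finsetSum (Finset.range j) fun i hi =>
      (ih i (Finset.mem_range.1 hi)).mul
        (tendsto_coeff_prod_range (k := j + 1) i fun m _ => hr m))).congr' ?_
    filter_upwards [eventually_ge_atTop j] with n hn
    rw [h.coeff_succ (by omega : j + 1 ≤ n + 1), Finset.sum_range_succ,
      h.coeff_prod_range n j _ le_rfl, if_pos rfl, mul_one, PowerSeries.coeff_one,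
      if_neg j.succ_ne_zero]
    ring

theorem exists_tendsto_coeff {c : ℕ → A} (ha : ∀ i, Tendsto (fun n => a n i) atTop (𝓝 (c i)))
    (k : ℕ) : ∃ x, Tendsto (fun n => PowerSeries.coeff k (r n)) atTop (𝓝 x) := by
  induction k using Nat.strong_induction_on with
  | _ k ih =>
    cases k with
    | zero =>
      obtain ⟨u, hu, -⟩ := h.exists_eq_X_mul
      exact ⟨0, tendsto_const_nhds.congr fun n => by rw [hu, PowerSeries.coeff_zero_X_mul]⟩
    | succ k =>
      choose! x hx using ih
      refine ⟨_, (tendsto_const_nhds.add (tendsto_finsetSum (Finset.range k) fun i _ =>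
        (ha i).mul (tendsto_coeff_prod_range (ρ := PowerSeries.mk x) i fun m hm => ?_))).congr'
          ((eventually_ge_atTop k).mono fun n hn => (h.coeff_succ (by omega)).symm)⟩
      rw [PowerSeries.coeff_mk]
      exact hx m (by omega)

end IsRatioRecurrence

end RatioRecurrence

/-! ### Moments -/

theorem coeff_one_add_X_mul_mul {A : Type*} [CommSemiring A] (c : ℕ → A) (f : PowerSeries A)
    (s : ℕ) : PowerSeries.coeff s ((1 + PowerSeries.X * PowerSeries.mk c) * f) =
      PowerSeries.coeff s f + ∑ i ∈ Finset.range s, c i * PowerSeries.coeff (s - (i + 1)) f := by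
  rw [add_mul, one_mul, map_add, mul_assoc]
  cases s with
  | zero => rw [PowerSeries.coeff_zero_X_mul, Finset.sum_range_zero]
  | succ s =>
    rw [PowerSeries.coeff_succ_X_mul, PowerSeries.coeff_mul,
      Finset.Nat.sum_antidiagonal_eq_sum_range_succ_mk]
    simp only [PowerSeries.coeff_mk, Nat.add_sub_add_right]

section Moments

variable {μ : Measure ℂ} [IsFiniteMeasure μ] (hc : IsCompact μ.support) (hi : μ.support.Infinite)
include hc hi

theorem opCoeff_X_pow_succ_mul_monicOP {j s n : ℕ} (hs : s ≤ n + 1) :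
    opCoeff μ (n + (j + 1) - s) (X ^ (j + 1) * monicOP μ n) =
      opCoeff μ (n + 1 + j - s) (X ^ j * monicOP μ (n + 1)) +
        ∑ i ∈ Finset.range s, recCoeff μ n i *
          opCoeff μ (n - i + j - (s - (i + 1))) (X ^ j * monicOP μ (n - i)) := by
  rw [pow_succ, mul_assoc, X_mul_monicOP hc hi, mul_add, Finset.mul_sum, opCoeff_add hc,
    opCoeff_sum hc, add_right_comm n 1 j, ← add_assoc]
  congr 1
  simp only [mul_left_comm (X ^ j : ℂ[X]), opCoeff_C_mul]
  rw [← Finset.sum_subset (Finset.range_mono hs)]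
  · refine Finset.sum_congr rfl fun i hi => ?_
    rw [show n + j + 1 - s = n - i + j - (s - (i + 1)) by
      have := Finset.mem_range.1 hi; omega]
  · intro i hin his
    rw [opCoeff_eq_zero hc hi, mul_zero]
    rw [degree_mul, degree_X_pow, degree_monicOP]
    norm_cast
    simp only [Finset.mem_range] at hin his
    omega

theorem tendsto_opCoeff_X_pow_mul_monicOP {c : ℕ → ℂ}
    (ha : ∀ i, Tendsto (fun n => recCoeff μ n i) atTop (𝓝 (c i))) (j s : ℕ) :
    Tendsto (fun n => opCoeff μ (n + j - s) (X ^ j * monicOP μ n)) atTop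
      (𝓝 (PowerSeries.coeff s ((1 + PowerSeries.X * PowerSeries.mk c) ^ j))) := by
  induction j generalizing s with
  | zero =>
    simp only [pow_zero, one_mul, add_zero, PowerSeries.coeff_one]
    refine tendsto_const_nhds.congr' ?_
    filter_upwards [eventually_ge_atTop s] with n hn
    split_ifs with hs
    · rw [hs, Nat.sub_zero, opCoeff_monicOP_self hc hi]
    · rw [opCoeff_monicOP_of_ne hc hi (by omega)]
  | succ j ih =>
    rw [pow_succ' (1 + PowerSeries.X * PowerSeries.mk c), coeff_one_add_X_mul_mul]
    refine (((ih s).comp (tendsto_add_atTop_nat 1)).add (tendsto_finsetSum _ fun i _ =>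
      (ha i).mul ((ih (s - (i + 1))).comp (tendsto_sub_atTop_nat i)))).congr' ?_
    filter_upwards [eventually_ge_atTop s] with n hn
    exact (opCoeff_X_pow_succ_mul_monicOP hc hi (by omega)).symm

theorem tendsto_moment {c : ℕ → ℂ} (hd : ∀ i, HasDiagonalLimit μ i (c i)) (j : ℕ) :
    Tendsto (moment μ j) atTop
      (𝓝 (PowerSeries.coeff j ((1 + PowerSeries.X * PowerSeries.mk c) ^ j))) := by
  have h := tendsto_opCoeff_X_pow_mul_monicOP hc hi
    (fun i => (hasDiagonalLimit_iff hc hi i (c i)).1 (hd i)) j j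
  simp only [Nat.add_sub_cancel] at h
  exact h.congr fun n => (moment_eq_opCoeff hc hi j n).symm

end Moments

/-! ### Ratio limits and diagonal limits -/

theorem sphereInv_of_ne_zero {w : ℂ} (hw : w ≠ 0) : sphereInv w = OnePoint.some w⁻¹ := if_neg hw

theorem sphereInv_zero : sphereInv 0 = OnePoint.infty := if_pos rfl

theorem sphereInv_inv {z : ℂ} (hz : z ≠ 0) : sphereInv z⁻¹ = OnePoint.some z := by
  rw [sphereInv_of_ne_zero (inv_ne_zero hz), inv_inv]

theorem exists_comp_sphereInv_eq (g : ℂ → ℂ) :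
    ∃ f : OnePoint ℂ → ℂ, ∀ w, f (sphereInv w) = g w := by
  refine ⟨fun p => p.elim (g 0) fun z => g z⁻¹, fun w => ?_⟩
  rcases eq_or_ne w 0 with rfl | hw
  · rw [sphereInv_zero]
    rfl
  · simp only [sphereInv_of_ne_zero hw, OnePoint.elim_some, inv_inv]

theorem inv_mem_ball {R : ℝ} (hR : 0 < R) {z : ℂ} (hz : R < ‖z‖) : z⁻¹ ∈ Metric.ball 0 R⁻¹ := by
  rw [mem_ball_zero_iff, norm_inv]
  exact inv_strictAnti₀ hR hz

theorem analyticOutside_iff {R : ℝ} (hR : 0 < R) {f : OnePoint ℂ → ℂ} :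
    AnalyticOutside R f ↔
      DifferentiableOn ℂ (fun w => f (sphereInv w)) (Metric.ball 0 R⁻¹) := by
  have hne : ∀ {z : ℂ}, R < ‖z‖ → z ≠ 0 := fun hz => norm_pos_iff.1 (hR.trans hz)
  refine ⟨fun h w hw => ?_, fun h => ⟨fun z hz => ?_, ?_⟩⟩
  · refine AnalyticAt.differentiableWithinAt ?_
    rcases eq_or_ne w 0 with rfl | hw0
    · exact h.2
    · refine ((h.1 _ (lt_norm_inv_of_mem_ball hR hw0 hw)).comp (analyticAt_inv hw0)).congr ?_
      filter_upwards [isOpen_ne.mem_nhds hw0] with v hv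
      rw [Function.comp_apply, sphereInv_of_ne_zero hv]
  · have hz0 := hne hz
    refine ((h.analyticAt (Metric.isOpen_ball.mem_nhds (inv_mem_ball hR hz))).comp
      (analyticAt_inv hz0)).congr ?_
    filter_upwards [isOpen_ne.mem_nhds hz0] with v hv
    rw [Function.comp_apply, sphereInv_inv hv]
  · exact h.analyticAt (Metric.ball_mem_nhds 0 (inv_pos.2 hR))

theorem HasRatioLimit.tendsto_ratioAtInfty {μ : Measure ℂ} {R : ℝ} {f : OnePoint ℂ → ℂ}
    (h : HasRatioLimit μ R f) (hR : 0 < R) {w : ℂ} (hw : w ∈ Metric.ball 0 R⁻¹) :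
    Tendsto (fun n => ratioAtInfty μ n w) atTop (𝓝 (f (sphereInv w))) := by
  unfold ratioAtInfty
  rcases eq_or_ne w 0 with rfl | hw0
  · rw [sphereInv_zero]
    exact h.2.2
  · rw [sphereInv_of_ne_zero hw0]
    exact (h.2.1 _ (lt_norm_inv_of_mem_ball hR hw0 hw)).2

theorem hasRatioLimit_of_tendsto_ratioAtInfty {μ : Measure ℂ} {R : ℝ} (hR : 0 < R)
    {f : OnePoint ℂ → ℂ} (hne : ∀ z : ℂ, R < ‖z‖ → ∀ n, (monicOP μ n).eval z ≠ 0)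
    (hf : DifferentiableOn ℂ (fun w => f (sphereInv w)) (Metric.ball 0 R⁻¹))
    (hlim : ∀ w ∈ Metric.ball (0 : ℂ) R⁻¹,
      Tendsto (fun n => ratioAtInfty μ n w) atTop (𝓝 (f (sphereInv w)))) :
    HasRatioLimit μ R f := by
  unfold ratioAtInfty at hlim
  refine ⟨(analyticOutside_iff hR).2 hf, fun z hz => ⟨.of_forall fun n => hne z hz (n + 1), ?_⟩, ?_⟩
  · have h := hlim z⁻¹ (inv_mem_ball hR hz)
    rwa [sphereInv_inv (norm_pos_iff.1 (hR.trans hz))] at h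
  · have h := hlim 0 (Metric.mem_ball_self (inv_pos.2 hR))
    rwa [sphereInv_zero] at h

section Equivalence

variable {μ : Measure ℂ} [IsFiniteMeasure μ] {R : ℝ} (hR0 : 0 < R)
  (hR : μ.support ⊆ Metric.closedBall 0 R) (hi : μ.support.Infinite)
include hR0 hR hi

theorem isRatioRecurrence_ratioAtInfty :
    IsRatioRecurrence (recCoeff μ) fun n => taylorSeriesAtZero (ratioAtInfty μ n) := by
  intro n
  have hball : Metric.ball (0 : ℂ) R⁻¹ ∈ 𝓝 0 := Metric.ball_mem_nhds 0 (inv_pos.2 hR0)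
  have hana : ∀ m, AnalyticAt ℂ (ratioAtInfty μ m) 0 := fun m =>
    (differentiableOn_ratioAtInfty hR0 hR hi m).analyticAt hball
  have hprod : ∀ i, AnalyticAt ℂ
      (fun w => ∏ s ∈ Finset.range (i + 1), ratioAtInfty μ (n - s) w) 0 := fun i =>
    (Finset.range (i + 1)).analyticAt_fun_prod fun s _ => hana (n - s)
  have hterm : ∀ i, AnalyticAt ℂ (fun w => recCoeff μ n i *
      ∏ s ∈ Finset.range (i + 1), ratioAtInfty μ (n - s) w) 0 := fun i =>
    analyticAt_const.mul (hprod i)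
  have hsum := (Finset.range (n + 1)).analyticAt_fun_sum fun i _ => hterm i
  have heq := Filter.mem_of_superset hball fun w hw => ratioAtInfty_eq hR0 hR hi hw n
  beta_reduce
  rw [taylorSeriesAtZero_congr heq, taylorSeriesAtZero_mul (f := fun w => w) analyticAt_id
    (analyticAt_const.fun_add hsum), taylorSeriesAtZero_id,
    taylorSeriesAtZero_add analyticAt_const hsum, taylorSeriesAtZero_const, map_one,
    taylorSeriesAtZero_sum _ fun i _ => hterm i]
  simp only [taylorSeriesAtZero_mul analyticAt_const (hprod _), taylorSeriesAtZero_const,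
    taylorSeriesAtZero_prod _ fun s _ => hana (n - s)]

theorem diffContOnCl_ratioAtInfty {ρ : ℝ} (hρ : ρ < R⁻¹) (n : ℕ) :
    DiffContOnCl ℂ (ratioAtInfty μ n) (Metric.ball 0 ρ) :=
  (differentiableOn_ratioAtInfty hR0 hR hi n).diffContOnCl_ball
    (Metric.closedBall_subset_ball hρ)

end Equivalence

section Limits

variable {μ : Measure ℂ} [IsFiniteMeasure μ] (hc : IsCompact μ.support) (hi : μ.support.Infinite)
include hc hi

theorem HasRatioLimit.hasDiagonalLimit {R : ℝ} {f : OnePoint ℂ → ℂ} (h : HasRatioLimit μ R f)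
    (hR : 0 < R) (j : ℕ) :
    HasDiagonalLimit μ j (symbolCoeff (taylorSeriesAtZero fun w => f (sphereInv w)) j) := by
  obtain ⟨S, hS0, hS⟩ := hc.isBounded.subset_closedBall_lt 0 0
  obtain ⟨ρ, hρ0, hρ⟩ := exists_between (lt_min (inv_pos.2 hR) (inv_pos.2 hS0))
  obtain ⟨hρR, hρS⟩ := lt_min_iff.1 hρ
  have hsubset : Metric.closedBall (0 : ℂ) ρ ⊆ Metric.ball 0 R⁻¹ :=
    Metric.closedBall_subset_ball hρR
  rw [hasDiagonalLimit_iff hc hi]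
  refine (isRatioRecurrence_ratioAtInfty hS0 hS hi).tendsto_symbolCoeff ?_ j
  exact tendsto_coeff_taylorSeriesAtZero hρ0 (diffContOnCl_ratioAtInfty hS0 hS hi hρS)
    (fun n w hw => norm_ratioAtInfty_le hS0 hS hi hρ0 hρS n (Metric.sphere_subset_closedBall hw))
    (((analyticOutside_iff hR).1 h.1).diffContOnCl_ball hsubset)
    fun w hw => h.tendsto_ratioAtInfty hR (hsubset (Metric.sphere_subset_closedBall hw))

theorem exists_hasRatioLimit {c : ℕ → ℂ} (hd : ∀ j, HasDiagonalLimit μ j (c j)) :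
    ∃ R : ℝ, 0 < R ∧ ∃ f : OnePoint ℂ → ℂ, HasRatioLimit μ R f := by
  obtain ⟨S, hS0, hS⟩ := hc.isBounded.subset_closedBall_lt 0 0
  obtain ⟨ρ, hρ0, hρS⟩ := exists_between (inv_pos.2 hS0)
  have hrec := isRatioRecurrence_ratioAtInfty hS0 hS hi
  choose x hx using hrec.exists_tendsto_coeff fun i => (hasDiagonalLimit_iff hc hi i (c i)).1 (hd i)
  have hF := diffContOnCl_ratioAtInfty hS0 hS hi hρS
  have hB := fun n w hw => norm_ratioAtInfty_le hS0 hS hi hρ0 hρS n (w := w)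
    (Metric.sphere_subset_closedBall hw)
  have hx_le : ∀ k, ‖x k‖ ≤ (ρ⁻¹ - S)⁻¹ / ρ ^ k := fun k => le_of_tendsto (hx k).norm
    (.of_forall fun n => norm_coeff_taylorSeriesAtZero_le hρ0 hF hB n k)
  obtain ⟨f, hf⟩ : ∃ f : OnePoint ℂ → ℂ, ∀ w, f (sphereInv w) = ∑' k, x k * w ^ k :=
    exists_comp_sphereInv_eq _
  refine ⟨ρ⁻¹, inv_pos.2 hρ0, f, hasRatioLimit_of_tendsto_ratioAtInfty (inv_pos.2 hρ0) ?_ ?_ ?_⟩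
  · exact fun z hz => eval_monicOP_ne_zero hS hi (((lt_inv_comm₀ hS0 hρ0).2 hρS).trans hz)
  · simp only [hf, inv_inv]
    exact differentiableOn_tsum_mul_pow hx_le
  · simp only [hf, inv_inv]
    exact fun w hw => tendsto_tsum_of_tendsto_coeff_taylorSeriesAtZero hρ0 hF hB hx hw

end Limits

end BergmanShift

end

theorem theorem1p2 (μ : MeasureTheory.Measure ℂ) [MeasureTheory.IsFiniteMeasure μ]
    (hcompact : IsCompact μ.support) (hinfinite : μ.support.Infinite) :
    ((∃ R : ℝ, 0 < R ∧ ∃ f : OnePoint ℂ → ℂ, BergmanShift.HasRatioLimit μ R f) ↔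
      (∀ j : ℕ, ∃ c : ℂ, BergmanShift.HasDiagonalLimit μ j c)) ∧
    (((∃ R : ℝ, 0 < R ∧ ∃ f : OnePoint ℂ → ℂ, BergmanShift.HasRatioLimit μ R f) ∨
      (∀ j : ℕ, ∃ c : ℂ, BergmanShift.HasDiagonalLimit μ j c)) →
      ∀ j : ℕ, ∃ L : ℂ,
        Tendsto (fun n => BergmanShift.moment μ j n) atTop (𝓝 L) ∧
        ∀ (ν : MeasureTheory.Measure ℂ) [MeasureTheory.IsFiniteMeasure ν],
          IsCompact ν.support → ν.support.Infinite →
          ((∃ R : ℝ, 0 < R ∧ ∃ f : OnePoint ℂ → ℂ,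
              BergmanShift.HasRatioLimit μ R f ∧ BergmanShift.HasRatioLimit ν R f) ∨
            (∀ i : ℕ, ∃ c : ℂ,
              BergmanShift.HasDiagonalLimit μ i c ∧ BergmanShift.HasDiagonalLimit ν i c)) →
          Tendsto (fun n => BergmanShift.moment ν j n) atTop (𝓝 L)) := by
  refine ⟨⟨?_, fun h => ?_⟩, fun h j => ?_⟩
  · rintro ⟨R, hR, f, hf⟩ j
    exact ⟨_, hf.hasDiagonalLimit hcompact hinfinite hR j⟩
  · choose c hc using h
    exact BergmanShift.exists_hasRatioLimit hcompact hinfinite hc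
  · have hdiag : ∀ i, ∃ c, BergmanShift.HasDiagonalLimit μ i c :=
      h.elim (fun ⟨R, hR, f, hf⟩ i => ⟨_, hf.hasDiagonalLimit hcompact hinfinite hR i⟩) id
    choose c hc using hdiag
    refine ⟨_, BergmanShift.tendsto_moment hcompact hinfinite hc j, fun ν _ hνc hνi hν =>
      BergmanShift.tendsto_moment hνc hνi (fun i => ?_) j⟩
    obtain ⟨d, hμd, hνd⟩ :
        ∃ d, BergmanShift.HasDiagonalLimit μ i d ∧ BergmanShift.HasDiagonalLimit ν i d :=
      hν.elim (fun ⟨R, hR, f, hμf, hνf⟩ => ⟨_, hμf.hasDiagonalLimit hcompact hinfinite hR i,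
        hνf.hasDiagonalLimit hνc hνi hR i⟩) fun h => h i
    rwa [tendsto_nhds_unique (hc i) hμd]
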